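/- Let $\{\gamma_t\}_{t\ge 1}$ be a sequence of Borel probability measures on a Polish space $\mathcal Y$, let $\gamma$ be another Borel probability measure on $\mathcal Y$, and let $h:\mathcal Y\times\mathcal Y\to\mathbb R$ be a measurable symmetric function, integrable with respect to $\gamma\otimes\gamma$. On a probability space, for all $n,t$, let $Y_1^{(t)},\dots,Y_n^{(t)}$ be i.i.d. with law $\gamma_t$ (no relation is assumed between the samples for different $t$, and the sample may depend on $n$), and put \[ U_n^{(t)}=\frac1{n(n-1)}\sum_{i\ne j}h\bigl(Y_i^{(t)},Y_j^{(t)}\bigr),\qquad \theta_t=\mathbb E_{(Y,Y')\sim\gamma_t\otimes\gamma_t}[h(Y,Y')],\qquad \theta=\mathbb E_{(Y,Y')\sim\gamma\otimes\gamma}[h(Y,Y')]. \] Let $\nu_t=\mathbb E_{(Y,Y')\sim\gamma_t\otimes\gamma_t}\bigl[|h(Y,Y')-\theta_t|^3\bigr]^{1/3}\in[0,\infty]$ and assume $\limsup_{t\to\infty}\nu_t<\infty$. Assume that $\sigma_t^2=4\,\mathrm{Var}_{Y'\sim\gamma_t}\bigl[\mathbb E_{Y\sim\gamma_t}[h(Y,Y')]\bigr]$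 converges to a constant $\sigma^2$, $\sigma\ge 0$, as $t\to\infty$. Fix any mode in which $n,t\to\infty$ jointly, that is, any filter on $\mathbb N\times\mathbb N$ along which both $n\to\infty$ and $t\to\infty$: for example the unrestricted double limit ($\min(n,t)\to\infty$), or $n\to\infty$ with $t=t(n)\to\infty$. Assume that $\sqrt n(\theta_t-\theta)\to 0$ as $n,t\to\infty$ in this mode. Then, as $n,t\to\infty$ in the same mode: 1. if $\sigma>0$, then $\sqrt n\,(U_n^{(t)}-\theta)$ converges in distribution to $\mathcal N(0,\sigma^2)$; 2. if $\sigma=0$, then $\sqrt n\,(U_n^{(t)}-\theta)\to 0$ in probability. -/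

import Mathlib

open MeasureTheory ProbabilityTheory Filter Topology
open scoped NNReal ENNReal

noncomputable section

namespace ApproxUStat

variable {Y : Type*}

/-- The second-order U-statistic `(n (n - 1))⁻¹ ∑_{i ≠ j} h (y i) (y j)` of a sample
`y` of size `n`; the sum runs over all ordered pairs of distinct indices. -/
def uStat (h : Y → Y → ℝ) {n : ℕ} (y : Fin n → Y) : ℝ :=
  1 / ((n : ℝ) * ((n : ℝ) - 1)) * ∑ p ∈ (Finset.univ : Finset (Fin n)).offDiag, h (y p.1) (y p.2)

variable [MeasurableSpace Y]

/-- The mean `E[h(Y, Y')]` for `(Y, Y') ∼ μ ⊗ μ`. -/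
def kernelMean (h : Y → Y → ℝ) (μ : Measure Y) : ℝ :=
  ∫ p, h p.1 p.2 ∂(μ.prod μ)

/-- The root of the third absolute central moment, `E[|h(Y, Y') - E h(Y, Y')|³]^{1/3}` for
`(Y, Y') ∼ μ ⊗ μ`, as a value in `[0, ∞]`. -/
def centralMoment3 (h : Y → Y → ℝ) (μ : Measure Y) : ℝ≥0∞ :=
  eLpNorm (fun p : Y × Y => h p.1 p.2 - kernelMean h μ) 3 (μ.prod μ)

/-- The variance parameter `4 Var_{Y' ∼ μ}(E_{Y ∼ μ}[h(Y, Y')])`. -/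
def projVariance (h : Y → Y → ℝ) (μ : Measure Y) : ℝ :=
  4 * variance (fun y' => ∫ y, h y y' ∂μ) μ

end ApproxUStat

end

namespace ApproxUStat

/-! Center the kernel at the mean `θ_t` of `γ t` and split it (Hoeffding) into the projection `proj`
in each variable and a remainder `degen` that integrates to zero in either variable. Then `√n (U_n -
θ_t)` is a normalized i.i.d. sum of `2 * proj`, whose variance is exactly `projVariance`, plus a
degenerate term.

The summands change with `t`, so the CLT must be uniform in `t`:
`norm_charFun_normalized_sum_sub_le` bounds the distance between characteristic functions by the
third moment, the variance mismatch and `n` alone. In the degenerate term almost all pairs of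
summands are orthogonal (`integral_sum_degen_sq_le`), so its variance at scale `√n` is `O(1 / (n -
1))`. Both bounds need only an eventual bound `K` on the third central moments.

The resulting CLT holds in the full double limit, hence along `l`; only the shift `√n (θ_t - θ)`
depends on the mode. The value `σ = 0` is included: the limit is then a Dirac mass, and convergence
in law to a constant is convergence in probability. -/

/-! ### Characteristic functions and a quantitative CLT. -/

lemma norm_pow_sub_pow_le {z w : ℂ} (hz : ‖z‖ ≤ 1) (hw : ‖w‖ ≤ 1) (n : ℕ) :
    ‖z ^ n - w ^ n‖ ≤ n * ‖z - w‖ := by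
  induction n with
  | zero => simp
  | succ n ih =>
    have hzn : ‖z ^ n‖ ≤ 1 := by simpa using pow_le_one₀ (norm_nonneg z) hz
    calc ‖z ^ (n + 1) - w ^ (n + 1)‖ = ‖z ^ n * (z - w) + (z ^ n - w ^ n) * w‖ := by
          congr 1; ring
      _ ≤ ‖z ^ n‖ * ‖z - w‖ + ‖z ^ n - w ^ n‖ * ‖w‖ := by
          simpa using norm_add_le (z ^ n * (z - w)) ((z ^ n - w ^ n) * w)
      _ ≤ 1 * ‖z - w‖ + n * ‖z - w‖ * 1 := by gcongr
      _ = (n + 1 : ℕ) * ‖z - w‖ := by push_cast; ring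

/-- For `|x| ≤ 1` this is the exponential series remainder; for `|x| > 1` the triangle inequality
gives `2 + |x| + x² / 2`, which the cube dominates. The constant is not optimized. -/
lemma norm_exp_mul_I_sub_taylor_le (x : ℝ) :
    ‖Complex.exp (x * Complex.I) - (1 + x * Complex.I - x ^ 2 / 2)‖ ≤ 4 * |x| ^ 3 := by
  have hnorm : ‖(x : ℂ) * Complex.I‖ = |x| := by simp
  rcases le_or_gt |x| 1 with hx | hx
  · have h := Complex.exp_bound (x := x * Complex.I) (by rwa [hnorm]) (n := 3) (by norm_num)
    have hs : ∑ m ∈ Finset.range 3, ((x : ℂ) * Complex.I) ^ m / m.factorial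
        = 1 + x * Complex.I - x ^ 2 / 2 := by
      simp [Finset.sum_range_succ, mul_pow, Nat.factorial]
      ring
    rw [hs, hnorm] at h
    refine h.trans ?_
    norm_num [Nat.factorial]
    nlinarith [pow_nonneg (abs_nonneg x) 3]
  · have h1 : ‖Complex.exp (x * Complex.I)‖ = 1 := Complex.norm_exp_ofReal_mul_I x
    have h2 : ‖(1 + x * Complex.I - x ^ 2 / 2 : ℂ)‖ ≤ 1 + |x| + |x| ^ 2 / 2 := by
      refine (norm_sub_le _ _).trans ?_
      gcongr
      · refine (norm_add_le _ _).trans ?_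
        simp
      · simp
    refine (norm_sub_le _ _).trans ?_
    nlinarith [mul_pos (sub_pos.2 hx) (sub_pos.2 hx), pow_pos (sub_pos.2 hx) 3]

section CharFun

variable {α : Type*} [MeasurableSpace α] {μ : Measure α}

lemma norm_charFun_sub_taylor_le [IsProbabilityMeasure μ] {f : α → ℝ}
    (hf : AEMeasurable f μ) (hf3 : MemLp f 3 μ) (h0 : ∫ x, f x ∂μ = 0) (s : ℝ) :
    ‖charFun (μ.map f) s - (1 - ((∫ x, f x ^ 2 ∂μ : ℝ) : ℂ) * s ^ 2 / 2)‖
      ≤ 4 * |s| ^ 3 * ∫ x, |f x| ^ 3 ∂μ := by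
  have hf1 : Integrable f μ := memLp_one_iff_integrable.1 (hf3.mono_exponent (by norm_num))
  have hf2 : Integrable (fun x => f x ^ 2) μ :=
    (hf3.mono_exponent (p := 2) (by norm_num)).integrable_sq
  have hf3' : Integrable (fun x => |f x| ^ 3) μ := by
    simpa using hf3.integrable_norm_pow (p := 3) (by norm_num)
  have hexp : Integrable (fun x => Complex.exp ((s * f x : ℝ) * Complex.I)) μ := by
    refine Integrable.of_bound (by fun_prop) 1 (ae_of_all _ fun x => ?_)
    rw [Complex.norm_exp_ofReal_mul_I]
  have hlin : Integrable (fun x => ((s * f x : ℝ) : ℂ) * Complex.I) μ :=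
    ((hf1.const_mul s).ofReal).mul_const _
  have hsq_eq : ∀ x, ((s * f x : ℝ) : ℂ) ^ 2 / 2 = ((s ^ 2 / 2 * f x ^ 2 : ℝ) : ℂ) := by
    intro x
    push_cast
    ring
  have hsq : Integrable (fun x => ((s * f x : ℝ) : ℂ) ^ 2 / 2) μ := by
    simp_rw [hsq_eq]
    exact (hf2.const_mul (s ^ 2 / 2)).ofReal
  have hlin0 : ∫ x, ((s * f x : ℝ) : ℂ) * Complex.I ∂μ = 0 := by
    rw [integral_mul_const, integral_complex_ofReal, integral_const_mul, h0]
    simp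
  have hsq' : ∫ x, ((s * f x : ℝ) : ℂ) ^ 2 / 2 ∂μ = ((∫ x, f x ^ 2 ∂μ : ℝ) : ℂ) * s ^ 2 / 2 := by
    simp_rw [hsq_eq]
    rw [integral_complex_ofReal, integral_const_mul]
    push_cast
    ring
  have hmap : charFun (μ.map f) s = ∫ x, Complex.exp ((s * f x : ℝ) * Complex.I) ∂μ := by
    rw [charFun_apply_real, integral_map hf (by fun_prop)]
    push_cast
    rfl
  have hone : Integrable (fun _ : α => (1 : ℂ)) μ := integrable_const 1
  have hsum : Integrable (fun x => 1 + ((s * f x : ℝ) : ℂ) * Complex.I) μ := hone.add hlin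
  have hdiff : Integrable
      (fun x => 1 + ((s * f x : ℝ) : ℂ) * Complex.I - ((s * f x : ℝ) : ℂ) ^ 2 / 2) μ := hsum.sub hsq
  have key : charFun (μ.map f) s - (1 - ((∫ x, f x ^ 2 ∂μ : ℝ) : ℂ) * s ^ 2 / 2)
      = ∫ x, (Complex.exp ((s * f x : ℝ) * Complex.I)
        - (1 + (s * f x : ℝ) * Complex.I - ((s * f x : ℝ) : ℂ) ^ 2 / 2)) ∂μ := by
    rw [integral_sub hexp hdiff, integral_sub hsum hsq, integral_add hone hlin, hlin0, hsq', hmap]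
    simp
  rw [key]
  calc _ ≤ ∫ x, 4 * |s| ^ 3 * |f x| ^ 3 ∂μ := by
        refine norm_integral_le_of_norm_le (hf3'.const_mul _) (ae_of_all _ fun x => ?_)
        refine (norm_exp_mul_I_sub_taylor_le _).trans_eq ?_
        rw [abs_mul]; ring
    _ = _ := by rw [integral_const_mul]

lemma integral_abs_pow_le {f : α → ℝ} (hf : AEStronglyMeasurable f μ) {K : ℝ≥0} {k : ℕ}
    (hk : k ≠ 0) (hK : eLpNorm f k μ ≤ K) : ∫ x, |f x| ^ k ∂μ ≤ K ^ k := by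
  have hfk : MemLp f k μ := ⟨hf, hK.trans_lt ENNReal.coe_lt_top⟩
  rw [hfk.eLpNorm_eq_integral_rpow_norm (by simpa using hk) (by simp),
    ← ENNReal.ofReal_coe_nnreal, ENNReal.ofReal_le_ofReal_iff K.coe_nonneg] at hK
  have hI : 0 ≤ ∫ x, |f x| ^ k ∂μ := integral_nonneg fun x => by positivity
  simp only [ENNReal.toReal_natCast, Real.rpow_natCast, Real.norm_eq_abs] at hK
  calc ∫ x, |f x| ^ k ∂μ = ((∫ x, |f x| ^ k ∂μ) ^ ((k : ℝ)⁻¹)) ^ k :=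
        (Real.rpow_inv_natCast_pow hI hk).symm
    _ ≤ K ^ k := by gcongr

lemma eLpNorm_two_le_of_integral_sq_le {f : α → ℝ} (hf : MemLp f 2 μ) {c : ℝ}
    (hc : ∫ x, f x ^ 2 ∂μ ≤ c) : eLpNorm f 2 μ ≤ ENNReal.ofReal (√c) := by
  rw [hf.eLpNorm_eq_integral_rpow_norm (by norm_num) (by norm_num)]
  refine ENNReal.ofReal_le_ofReal ?_
  rw [Real.sqrt_eq_rpow]
  simp only [ENNReal.toReal_ofNat, Real.rpow_ofNat, Real.norm_eq_abs, sq_abs, one_div]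
  gcongr

end CharFun

/-- Quantitative central limit theorem, at the level of characteristic functions, for normalized
sums of i.i.d. centered variables with a finite third moment. -/
lemma norm_charFun_normalized_sum_sub_le {α Ω : Type*} [MeasurableSpace α] [MeasurableSpace Ω]
    {μ : Measure α} [IsProbabilityMeasure μ] {P : Measure Ω} [IsProbabilityMeasure P]
    {n : ℕ} (hn : 0 < n) {Y : Fin n → Ω → α} (hY : ∀ i, HasLaw (Y i) μ P) (hind : iIndepFun Y P)
    {f : α → ℝ} (hf : Measurable f) {K : ℝ≥0} (hK : eLpNorm f 3 μ ≤ K)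
    (h0 : ∫ x, f x ∂μ = 0) (σ : ℝ≥0) (s : ℝ) :
    ‖charFun (P.map fun ω => (√n)⁻¹ * ∑ i, f (Y i ω)) s - charFun (gaussianReal 0 (σ ^ 2)) s‖
      ≤ 4 * |s| ^ 3 * K ^ 3 * (√n)⁻¹ + |(∫ x, f x ^ 2 ∂μ) - σ ^ 2| * s ^ 2 / 2
        + (σ ^ 2 * s ^ 2 / 2) ^ 2 * (n : ℝ)⁻¹ := by
  have hn' : (0 : ℝ) < n := by exact_mod_cast hn
  set r : ℝ := (√n)⁻¹ * s with hr
  have hr2 : r ^ 2 = s ^ 2 * (n : ℝ)⁻¹ := by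
    rw [hr, mul_pow, inv_pow, Real.sq_sqrt hn'.le]; ring
  have hr3 : |r| ^ 3 = |s| ^ 3 * (√n)⁻¹ * (n : ℝ)⁻¹ := by
    rw [hr, abs_mul, abs_of_pos (by positivity : (0 : ℝ) < (√n)⁻¹), mul_pow, pow_succ, inv_pow,
      Real.sq_sqrt hn'.le]
    ring
  have hYm : ∀ i, AEMeasurable (Y i) P := fun i => (hY i).aemeasurable
  have hcf : charFun (P.map fun ω => (√n)⁻¹ * ∑ i, f (Y i ω)) s = charFun (μ.map f) r ^ n := by
    have hfY : ∀ i, AEMeasurable (fun ω => f (Y i ω)) P := fun i => hf.comp_aemeasurable (hYm i)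
    rw [charFun_map_mul_comp (Finset.aemeasurable_fun_sum _ fun i _ => hfY i),
      iIndepFun.charFun_map_fun_sum_eq_prod hfY (hind.comp (fun _ => f) fun _ => hf)]
    have : ∀ i, P.map (fun ω => f (Y i ω)) = μ.map f := fun i => by
      rw [← (hY i).map_eq, AEMeasurable.map_map_of_aemeasurable hf.aemeasurable (hYm i)]
      rfl
    simp [this, hr]
  -- The Gaussian characteristic function is the `n`-th power of `exp (-x)`, so two `n`-th powers in
  -- the unit disc are compared, at the cost of a factor `n`.
  set x : ℝ := σ ^ 2 * s ^ 2 / 2 * (n : ℝ)⁻¹ with hx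
  have hx0 : 0 ≤ x := by positivity
  have hgauss : charFun (gaussianReal 0 (σ ^ 2)) s = ((Real.exp (-x) : ℝ) : ℂ) ^ n := by
    rw [charFun_gaussianReal, Complex.ofReal_exp, ← Complex.exp_nat_mul]
    congr 1
    rw [hx]
    have : (n : ℂ) ≠ 0 := by exact_mod_cast hn.ne'
    push_cast
    field_simp
    simp
    ring
  have hprob : IsProbabilityMeasure (μ.map f) := Measure.isProbabilityMeasure_map hf.aemeasurable
  -- From `1 - x ≤ exp (-x) ≤ 1 / (1 + x) ≤ 1 - x + x²`, valid for every `x ≥ 0`, so `n` need not be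
  -- large.
  have hexp : |1 - x - Real.exp (-x)| ≤ x ^ 2 := by
    have h1 := Real.one_sub_le_exp_neg x
    have h2 : Real.exp (-x) ≤ (1 + x)⁻¹ := by
      rw [Real.exp_neg]
      gcongr
      linarith [Real.add_one_le_exp x]
    have h3 : (1 + x)⁻¹ ≤ 1 - x + x ^ 2 := by
      rw [inv_le_iff_one_le_mul₀ (by positivity)]
      nlinarith [pow_nonneg hx0 3]
    rw [abs_le]
    constructor <;> linarith
  set v := ∫ x, f x ^ 2 ∂μ with hv
  -- Three errors: Taylor remainder, variance mismatch, and `1 - x` against `exp (-x)`.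
  have hsplit : charFun (μ.map f) r - ((Real.exp (-x) : ℝ) : ℂ)
      = (charFun (μ.map f) r - (1 - (v : ℂ) * r ^ 2 / 2))
        + (((σ ^ 2 - v) * r ^ 2 / 2 : ℝ) : ℂ) + ((1 - x - Real.exp (-x) : ℝ) : ℂ) := by
    have : x = σ ^ 2 * r ^ 2 / 2 := by rw [hr2, hx]; ring
    have hxc : (x : ℂ) = σ ^ 2 * r ^ 2 / 2 := by rw [this]; push_cast; ring
    push_cast
    rw [hxc]
    ring
  have hf3 : MemLp f 3 μ := ⟨hf.aestronglyMeasurable, hK.trans_lt ENNReal.coe_lt_top⟩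
  have hone : ‖charFun (μ.map f) r - ((Real.exp (-x) : ℝ) : ℂ)‖
      ≤ 4 * |r| ^ 3 * K ^ 3 + |v - σ ^ 2| * r ^ 2 / 2 + x ^ 2 := by
    rw [hsplit]
    refine (norm_add₃_le).trans ?_
    gcongr
    · refine (norm_charFun_sub_taylor_le hf.aemeasurable hf3 h0 r).trans ?_
      gcongr
      exact integral_abs_pow_le hf.aestronglyMeasurable (by norm_num) (by simpa using hK)
    · rw [Complex.norm_real, Real.norm_eq_abs, abs_div, abs_mul, abs_sub_comm]
      simp
    · rwa [Complex.norm_real, Real.norm_eq_abs]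
  rw [hcf, hgauss]
  calc _ ≤ n * ‖charFun (μ.map f) r - ((Real.exp (-x) : ℝ) : ℂ)‖ := by
        refine norm_pow_sub_pow_le (norm_charFun_le_one _) ?_ n
        rw [Complex.norm_real, Real.norm_eq_abs, Real.abs_exp]
        exact Real.exp_le_one_iff.2 (by linarith)
    _ ≤ n * (4 * |r| ^ 3 * K ^ 3 + |v - σ ^ 2| * r ^ 2 / 2 + x ^ 2) := by gcongr
    _ = _ := by
        rw [hr3, hr2, hx]
        field_simp

/-! ### Perturbing limits in distribution, and constant limits. -/

/-- Adding deterministic shifts that tend to zero does not change a limit in distribution, along an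
arbitrary filter. -/
lemma tendstoInDistribution_add_tendsto_zero {ι Ω Ω' : Type*} [MeasurableSpace Ω]
    [MeasurableSpace Ω'] {P : Measure Ω} [IsProbabilityMeasure P] {P' : Measure Ω'}
    [IsProbabilityMeasure P'] {l : Filter ι} {X : ι → Ω → ℝ} {Z : Ω' → ℝ}
    (hX : TendstoInDistribution X l Z (fun _ => P) P') {r : ι → ℝ} (hr : Tendsto r l (𝓝 0)) :
    TendstoInDistribution (fun i ω => X i ω + r i) l Z (fun _ => P) P' := by
  have hXm := hX.forall_aemeasurable
  have hZ := hX.aemeasurable_limit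
  refine ⟨fun i => (hXm i).add_const _, hZ, ?_⟩
  -- The shifted law is the image under addition of the product with a Dirac mass at `r i`;
  -- continuity of products and of `diracProba` puts no restriction on the filter.
  have hprod := (ProbabilityMeasure.continuous_prod (α := ℝ) (β := ℝ)).tendsto
    (_, diracProba (0 : ℝ)) |>.comp
      (hX.tendsto.prodMk_nhds ((continuous_diracProba.tendsto (0 : ℝ)).comp hr))
  have hmap := ProbabilityMeasure.tendsto_map_of_tendsto_of_continuous _ _ hprod
    (f := fun p : ℝ × ℝ => p.1 + p.2) continuous_add
  have hadd (ν : Measure ℝ) [IsProbabilityMeasure ν] (c : ℝ) :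
      (ν.prod (Measure.dirac c)).map (fun p : ℝ × ℝ => p.1 + p.2) = ν.map (· + c) := by
    rw [Measure.prod_dirac, Measure.map_map (by fun_prop) (by fun_prop)]
    rfl
  refine (hmap.congr fun i => Subtype.ext ?_).trans (le_of_eq (congrArg _ (Subtype.ext ?_)))
  · have := Measure.isProbabilityMeasure_map (μ := P) (hXm i)
    symm
    calc P.map (fun ω => X i ω + r i) = (P.map (X i)).map (· + r i) :=
          (AEMeasurable.map_map_of_aemeasurable (g := (· + r i)) (by fun_prop) (hXm i)).symm
      _ = _ := (hadd _ _).symm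
  · have := Measure.isProbabilityMeasure_map (μ := P') hZ
    symm
    calc P'.map Z = (P'.map Z).map (· + 0) := by simp
      _ = _ := (hadd _ _).symm

/-- Portmanteau for the closed set `{ε ≤ ‖x‖}`: its frontier lies inside it, and it is null for the
Dirac mass at zero. -/
lemma tendstoInMeasure_zero_of_tendstoInDistribution {ι Ω : Type*} [MeasurableSpace Ω]
    {P : Measure Ω} [IsProbabilityMeasure P] {l : Filter ι} {X : ι → Ω → ℝ}
    (hX : TendstoInDistribution X l (id : ℝ → ℝ) (fun _ => P) (gaussianReal 0 0)) :
    TendstoInMeasure P X l (fun _ => 0) := by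
  rw [tendstoInMeasure_iff_norm]
  intro ε hε
  have hc : IsClosed {x : ℝ | ε ≤ ‖x‖} := isClosed_le continuous_const continuous_norm
  have hnot : (0 : ℝ) ∉ {x : ℝ | ε ≤ ‖x‖} := by simpa using hε
  have hnull : gaussianReal 0 0 {x : ℝ | ε ≤ ‖x‖} = 0 := by
    rw [gaussianReal_zero_var, Measure.dirac_apply' _ hc.measurableSet]
    simp [hε]
  have h := ProbabilityMeasure.tendsto_measure_of_null_frontier_of_tendsto' hX.tendsto
    (E := {x : ℝ | ε ≤ ‖x‖})
    (by simpa using measure_mono_null hc.frontier_subset hnull)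
  simp only [ProbabilityMeasure.coe_mk, Measure.map_id, hnull] at h
  refine h.congr fun i => ?_
  rw [Measure.map_apply_of_aemeasurable (hX.forall_aemeasurable i) hc.measurableSet]
  simp

/-! ### Hoeffding decomposition of the kernel. -/

section Hoeffding

variable {𝒴 : Type*} [MeasurableSpace 𝒴] {h : 𝒴 → 𝒴 → ℝ} {μ : Measure 𝒴}

/-- The centered first-order projection of the kernel. -/
noncomputable def proj (h : 𝒴 → 𝒴 → ℝ) (μ : Measure 𝒴) (y' : 𝒴) : ℝ :=
  (∫ y, h y y' ∂μ) - kernelMean h μ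

/-- The degenerate, second-order part of the Hoeffding decomposition of the kernel. -/
noncomputable def degen (h : 𝒴 → 𝒴 → ℝ) (μ : Measure 𝒴) (p : 𝒴 × 𝒴) : ℝ :=
  h p.1 p.2 - kernelMean h μ - proj h μ p.1 - proj h μ p.2

lemma degen_swap (h_symm : ∀ y y', h y y' = h y' y) (x y : 𝒴) :
    degen h μ (x, y) = degen h μ (y, x) := by
  simp only [degen, h_symm x y]
  ring

lemma measurable_kernel (h_meas : Measurable (Function.uncurry h)) :
    Measurable fun p : 𝒴 × 𝒴 => h p.1 p.2 := h_meas

lemma memLp_sub_kernelMean (h_meas : Measurable (Function.uncurry h)) {K : ℝ≥0}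
    (hK : centralMoment3 h μ ≤ K) :
    MemLp (fun p : 𝒴 × 𝒴 => h p.1 p.2 - kernelMean h μ) 3 (μ.prod μ) :=
  ⟨((measurable_kernel h_meas).sub_const _).aestronglyMeasurable,
    lt_of_le_of_lt hK ENNReal.coe_lt_top⟩

variable [IsProbabilityMeasure μ]

lemma measurable_proj (h_meas : Measurable (Function.uncurry h)) : Measurable (proj h μ) := by
  have : StronglyMeasurable fun y' => ∫ y, h y y' ∂μ :=
    StronglyMeasurable.integral_prod_left' (f := Function.uncurry h) h_meas.stronglyMeasurable
  exact this.measurable.sub_const _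

lemma measurable_degen (h_meas : Measurable (Function.uncurry h)) : Measurable (degen h μ) := by
  have h1 := measurable_proj (μ := μ) h_meas
  exact (((measurable_kernel h_meas).sub_const _).sub (h1.comp measurable_fst)).sub
    (h1.comp measurable_snd)

lemma integrable_kernel (h_meas : Measurable (Function.uncurry h)) {K : ℝ≥0}
    (hK : centralMoment3 h μ ≤ K) :
    Integrable (fun p : 𝒴 × 𝒴 => h p.1 p.2) (μ.prod μ) := by
  have h1 := memLp_one_iff_integrable.1
    ((memLp_sub_kernelMean h_meas hK).mono_exponent (p := 1) (by norm_num))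
  refine (h1.add (integrable_const (kernelMean h μ))).congr (ae_of_all _ fun p => ?_)
  simp

/-- Averaging over one variable contracts `L³`: on almost every section `|∫| ≤ L¹ ≤ L³`, and Tonelli
integrates the cubes. -/
lemma eLpNorm_proj_le (h_meas : Measurable (Function.uncurry h)) {K : ℝ≥0}
    (hK : centralMoment3 h μ ≤ K) : eLpNorm (proj h μ) 3 μ ≤ K := by
  refine le_trans ?_ hK
  have hf : Measurable fun p : 𝒴 × 𝒴 => h p.1 p.2 - kernelMean h μ :=
    (measurable_kernel h_meas).sub_const _
  have h1 := eLpNorm_nnreal_pow_eq_lintegral (μ := μ) (f := proj h μ) (p := 3) (by norm_num)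
  have h2 := eLpNorm_nnreal_pow_eq_lintegral (μ := μ.prod μ)
    (f := fun p : 𝒴 × 𝒴 => h p.1 p.2 - kernelMean h μ) (p := 3) (by norm_num)
  have hint := (integrable_kernel h_meas hK).prod_left_ae
  have hle : eLpNorm (proj h μ) (3 : ℝ≥0) μ ^ ((3 : ℝ≥0) : ℝ)
      ≤ eLpNorm (fun p : 𝒴 × 𝒴 => h p.1 p.2 - kernelMean h μ) (3 : ℝ≥0) (μ.prod μ)
        ^ ((3 : ℝ≥0) : ℝ) := by
    rw [h1, h2, lintegral_prod_symm _ (by fun_prop)]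
    refine lintegral_mono_ae ?_
    filter_upwards [hint] with y hy
    have hm : Measurable fun x => h x y - kernelMean h μ :=
      hf.comp (measurable_id.prodMk measurable_const)
    rw [← eLpNorm_nnreal_pow_eq_lintegral (f := fun x => h x y - kernelMean h μ) (by norm_num)]
    gcongr
    have : proj h μ y = ∫ x, (h x y - kernelMean h μ) ∂μ := by
      rw [integral_sub hy (integrable_const _)]
      simp [proj]
    rw [this]
    refine (enorm_integral_le_lintegral_enorm _).trans ?_
    rw [← eLpNorm_one_eq_lintegral_enorm]
    exact eLpNorm_le_eLpNorm_of_exponent_le (by norm_num) hm.aestronglyMeasurable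
  exact (ENNReal.rpow_le_rpow_iff (by norm_num)).1 hle

lemma integrable_proj (h_meas : Measurable (Function.uncurry h)) {K : ℝ≥0}
    (hK : centralMoment3 h μ ≤ K) : Integrable (proj h μ) μ := by
  have : MemLp (proj h μ) 3 μ := ⟨(measurable_proj h_meas).aestronglyMeasurable,
    (eLpNorm_proj_le h_meas hK).trans_lt ENNReal.coe_lt_top⟩
  exact memLp_one_iff_integrable.1 (this.mono_exponent (by norm_num))

lemma integral_proj (h_meas : Measurable (Function.uncurry h)) {K : ℝ≥0}
    (hK : centralMoment3 h μ ≤ K) : ∫ y, proj h μ y ∂μ = 0 := by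
  have hi := integrable_kernel h_meas hK
  simp only [proj]
  rw [integral_sub hi.integral_prod_right (integrable_const _), ← integral_prod_symm _ hi]
  simp [kernelMean]

lemma integral_two_mul_proj_sq (h_meas : Measurable (Function.uncurry h)) {K : ℝ≥0}
    (hK : centralMoment3 h μ ≤ K) : ∫ y, (2 * proj h μ y) ^ 2 ∂μ = projVariance h μ := by
  have hi := integrable_kernel h_meas hK
  have hm : ∫ y', ∫ y, h y y' ∂μ ∂μ = kernelMean h μ := (integral_prod_symm _ hi).symm
  rw [projVariance, variance_eq_integral hi.integral_prod_right.aemeasurable, hm,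
    ← integral_const_mul]
  refine integral_congr_ae (ae_of_all _ fun y => ?_)
  simp only [proj]
  ring

lemma ae_integral_degen_eq_zero (h_meas : Measurable (Function.uncurry h)) {K : ℝ≥0}
    (hK : centralMoment3 h μ ≤ K) : ∀ᵐ y ∂μ, ∫ x, degen h μ (x, y) ∂μ = 0 := by
  filter_upwards [(integrable_kernel h_meas hK).prod_left_ae] with y hy
  have hp := integrable_proj h_meas hK
  have h1 : Integrable (fun x => h x y - kernelMean h μ) μ := hy.sub (integrable_const _)
  have h2 : Integrable (fun x => h x y - kernelMean h μ - proj h μ x) μ := h1.sub hp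
  simp only [degen]
  rw [integral_sub h2 (integrable_const _), integral_sub h1 hp, integral_proj h_meas hK,
    integral_sub hy (integrable_const _)]
  simp [proj]

lemma eLpNorm_degen_le (h_meas : Measurable (Function.uncurry h)) {K : ℝ≥0}
    (hK : centralMoment3 h μ ≤ K) : eLpNorm (degen h μ) 2 (μ.prod μ) ≤ (3 * K : ℝ≥0) := by
  have hm : AEStronglyMeasurable (fun p : 𝒴 × 𝒴 => h p.1 p.2 - kernelMean h μ) (μ.prod μ) :=
    ((measurable_kernel h_meas).sub_const _).aestronglyMeasurable
  have hg := measurable_proj (μ := μ) h_meas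
  have hg2 : eLpNorm (proj h μ) 3 μ ≤ K := eLpNorm_proj_le h_meas hK
  have h1 : eLpNorm (fun p : 𝒴 × 𝒴 => proj h μ p.1) 3 (μ.prod μ) ≤ K :=
    (eLpNorm_comp_measurePreserving hg.aestronglyMeasurable measurePreserving_fst).trans_le hg2
  have h2 : eLpNorm (fun p : 𝒴 × 𝒴 => proj h μ p.2) 3 (μ.prod μ) ≤ K :=
    (eLpNorm_comp_measurePreserving hg.aestronglyMeasurable measurePreserving_snd).trans_le hg2
  have hg1m : AEStronglyMeasurable (fun p : 𝒴 × 𝒴 => proj h μ p.1) (μ.prod μ) :=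
    (hg.comp measurable_fst).aestronglyMeasurable
  have hg2m : AEStronglyMeasurable (fun p : 𝒴 × 𝒴 => proj h μ p.2) (μ.prod μ) :=
    (hg.comp measurable_snd).aestronglyMeasurable
  calc eLpNorm (degen h μ) 2 (μ.prod μ) ≤ eLpNorm (degen h μ) 3 (μ.prod μ) :=
        eLpNorm_le_eLpNorm_of_exponent_le (by norm_num) (measurable_degen h_meas).aestronglyMeasurable
    _ ≤ eLpNorm (fun p : 𝒴 × 𝒴 => h p.1 p.2 - kernelMean h μ) 3 (μ.prod μ)
        + eLpNorm (fun p : 𝒴 × 𝒴 => proj h μ p.1) 3 (μ.prod μ)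
        + eLpNorm (fun p : 𝒴 × 𝒴 => proj h μ p.2) 3 (μ.prod μ) := by
        refine (eLpNorm_sub_le (hm.sub hg1m) hg2m (by norm_num)).trans ?_
        gcongr
        exact eLpNorm_sub_le hm hg1m (by norm_num)
    _ ≤ K + K + K := by gcongr; exact hK
    _ = (3 * K : ℝ≥0) := by push_cast; ring

end Hoeffding

/-! ### Second moment of the degenerate sum. -/

section Sample

variable {𝒴 Ω : Type*} [MeasurableSpace 𝒴] [MeasurableSpace Ω] {h : 𝒴 → 𝒴 → ℝ} {μ : Measure 𝒴}
  {P : Measure Ω} [IsProbabilityMeasure P] {n : ℕ} {Y : Fin n → Ω → 𝒴}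

lemma hasLaw_pair (hY : ∀ i, HasLaw (Y i) μ P) (hind : iIndepFun Y P) {i j : Fin n} (hij : i ≠ j) :
    HasLaw (fun ω => (Y i ω, Y j ω)) (μ.prod μ) P :=
  (hind.indepFun hij).hasLaw_prod (hY i) (hY j)

variable [IsProbabilityMeasure μ]

lemma memLp_degen_sample (h_meas : Measurable (Function.uncurry h)) {K : ℝ≥0}
    (hK : centralMoment3 h μ ≤ K) (hY : ∀ i, HasLaw (Y i) μ P) (hind : iIndepFun Y P) {i j : Fin n}
    (hij : i ≠ j) : MemLp (fun ω => degen h μ (Y i ω, Y j ω)) 2 P := by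
  have hd : MemLp (degen h μ) 2 (μ.prod μ) := ⟨(measurable_degen h_meas).aestronglyMeasurable,
    (eLpNorm_degen_le h_meas hK).trans_lt ENNReal.coe_lt_top⟩
  have hl := hasLaw_pair hY hind hij
  rw [← hl.map_eq] at hd
  exact hd.comp_of_map hl.aemeasurable

lemma integral_degen_sample_sq_le (h_meas : Measurable (Function.uncurry h)) {K : ℝ≥0}
    (hK : centralMoment3 h μ ≤ K) (hY : ∀ i, HasLaw (Y i) μ P) (hind : iIndepFun Y P) {i j : Fin n}
    (hij : i ≠ j) : ∫ ω, degen h μ (Y i ω, Y j ω) ^ 2 ∂P ≤ (3 * K) ^ 2 := by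
  have hm := measurable_degen (μ := μ) h_meas
  have h1 := (hasLaw_pair hY hind hij).integral_comp (f := fun p => degen h μ p ^ 2)
    (hm.pow_const 2).aestronglyMeasurable
  have h2 := integral_abs_pow_le (k := 2) hm.aestronglyMeasurable (by norm_num)
    (eLpNorm_degen_le h_meas hK)
  simp only [sq_abs] at h2
  calc _ = ∫ p, degen h μ p ^ 2 ∂(μ.prod μ) := h1
    _ ≤ _ := by exact_mod_cast h2

/-- Index `i` occurs only once, so integrating out `Y i` first kills the product by degeneracy.
Since `j` may equal `k` or `l`, the other three variables are kept with their joint law, and only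
their independence from `Y i` is used. -/
lemma integral_degen_mul_degen_eq_zero (h_meas : Measurable (Function.uncurry h)) {K : ℝ≥0}
    (hK : centralMoment3 h μ ≤ K) (hY : ∀ i, HasLaw (Y i) μ P) (hind : iIndepFun Y P)
    {i j k l : Fin n} (hij : i ≠ j) (hik : i ≠ k) (hil : i ≠ l) (hkl : k ≠ l) :
    ∫ ω, degen h μ (Y i ω, Y j ω) * degen h μ (Y k ω, Y l ω) ∂P = 0 := by
  have hm := measurable_degen (μ := μ) h_meas
  have hYm : ∀ i, AEMeasurable (Y i) P := fun i => (hY i).aemeasurable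
  let Z : Ω → 𝒴 × 𝒴 × 𝒴 := fun ω => (Y j ω, Y k ω, Y l ω)
  have hZm : AEMeasurable Z P := (hYm j).prodMk ((hYm k).prodMk (hYm l))
  have hZind : IndepFun (Y i) Z P :=
    (hind.indepFun_finset₀ {i} {j, k, l} (by simp [hij, hik, hil]) hYm).comp
      (φ := fun v : ({i} : Finset (Fin n)) → 𝒴 => v ⟨i, by simp⟩)
      (ψ := fun v : ({j, k, l} : Finset (Fin n)) → 𝒴 =>
        (v ⟨j, by simp⟩, v ⟨k, by simp⟩, v ⟨l, by simp⟩)) (by fun_prop) (by fun_prop)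
  have hZprob : IsProbabilityMeasure (P.map Z) := Measure.isProbabilityMeasure_map hZm
  have hlaw : HasLaw (fun ω => (Y i ω, Z ω)) (μ.prod (P.map Z)) P :=
    hZind.hasLaw_prod (hY i) ⟨hZm, rfl⟩
  let F : 𝒴 × 𝒴 × 𝒴 × 𝒴 → ℝ := fun p => degen h μ (p.1, p.2.1) * degen h μ p.2.2
  have hF : Measurable F := by fun_prop
  have hint : Integrable (fun ω => degen h μ (Y i ω, Y j ω) * degen h μ (Y k ω, Y l ω)) P :=
    (memLp_degen_sample h_meas hK hY hind hij).integrable_mul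
      (memLp_degen_sample h_meas hK hY hind hkl)
  have hFint : Integrable F (μ.prod (P.map Z)) := by
    rw [← hlaw.map_eq]
    exact (integrable_map_measure hF.aestronglyMeasurable hlaw.aemeasurable).2 hint
  -- Degeneracy holds only `μ`-a.e.; it transfers because the first marginal of `P.map Z` is `μ`.
  have hae : ∀ᵐ z ∂(P.map Z), ∫ x, degen h μ (x, z.1) ∂μ = 0 := by
    have h1 := ae_integral_degen_eq_zero h_meas hK
    have hfst : (P.map Z).map Prod.fst = μ := by
      rw [AEMeasurable.map_map_of_aemeasurable (by fun_prop) hZm, ← (hY j).map_eq]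
      rfl
    rw [← hfst] at h1
    have h2 := ae_of_ae_map (by fun_prop) h1
    rwa [hfst] at h2
  calc _ = ∫ p, F p ∂(μ.prod (P.map Z)) := hlaw.integral_comp hF.aestronglyMeasurable
    _ = ∫ z, ∫ x, F (x, z) ∂μ ∂(P.map Z) := integral_prod_symm _ hFint
    _ = ∫ z, 0 ∂(P.map Z) := by
        refine integral_congr_ae ?_
        filter_upwards [hae] with z hz
        simp only [F]
        rw [integral_mul_const, hz, zero_mul]
    _ = 0 := by simp

/-- A pair `p` correlates only with `p` and `p.swap`, so each of the `n (n - 1)` rows of the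
covariance matrix contributes at most two diagonal-size terms. -/
lemma integral_sum_degen_sq_le (h_meas : Measurable (Function.uncurry h))
    (h_symm : ∀ y y', h y y' = h y' y) {K : ℝ≥0} (hK : centralMoment3 h μ ≤ K)
    (hY : ∀ i, HasLaw (Y i) μ P) (hind : iIndepFun Y P) :
    ∫ ω, (∑ p ∈ (Finset.univ : Finset (Fin n)).offDiag, degen h μ (Y p.1 ω, Y p.2 ω)) ^ 2 ∂P
      ≤ 2 * (n * (n - 1)) * (3 * K) ^ 2 := by
  set S := (Finset.univ : Finset (Fin n)).offDiag
  let D : Fin n × Fin n → Ω → ℝ := fun p ω => degen h μ (Y p.1 ω, Y p.2 ω)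
  have hD : ∀ p ∈ S, MemLp (D p) 2 P := fun p hp =>
    memLp_degen_sample h_meas hK hY hind (by simpa [S] using hp)
  have hint : ∀ p ∈ S, ∀ q ∈ S, Integrable (fun ω => D p ω * D q ω) P := fun p hp q hq =>
    (hD p hp).integrable_mul (hD q hq)
  have hswap : ∀ p, D p.swap = D p := fun p => funext fun ω => degen_swap h_symm _ _
  have hzero : ∀ p ∈ S, ∀ q ∈ S, q ≠ p → q ≠ p.swap → ∫ ω, D p ω * D q ω ∂P = 0 := by
    rintro ⟨i, j⟩ hp ⟨k, l⟩ hq hne hne'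
    have hij : i ≠ j := by simpa [S] using hp
    have hkl : k ≠ l := by simpa [S] using hq
    simp only [ne_eq, Prod.mk.injEq, Prod.swap_prod_mk, not_and] at hne hne'
    by_cases hi : i ≠ k ∧ i ≠ l
    · exact integral_degen_mul_degen_eq_zero h_meas hK hY hind hij hi.1 hi.2 hkl
    -- If `i` is shared, `j` is not, as otherwise `q` would be `p` or its swap; symmetry lets `j`
    -- play the role of `i`.
    · have hj : j ≠ k ∧ j ≠ l := by grind
      rw [← hswap (i, j)]
      exact integral_degen_mul_degen_eq_zero h_meas hK hY hind hij.symm hj.1 hj.2 hkl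
  have hrow : ∀ p ∈ S, ∑ q ∈ S, ∫ ω, D p ω * D q ω ∂P ≤ 2 * (3 * K) ^ 2 := by
    intro p hp
    have hps : p.swap ∈ S := by
      simp only [S, Finset.mem_offDiag, Finset.mem_univ, true_and, Prod.fst_swap,
        Prod.snd_swap] at hp ⊢
      exact hp.symm
    have hpne : p ≠ p.swap := by
      simp only [S, Finset.mem_offDiag, Finset.mem_univ, true_and] at hp
      exact fun h => hp (congrArg Prod.fst h)
    have hsub : ({p, p.swap} : Finset _) ⊆ S := by
      simp [Finset.insert_subset_iff, hp, hps]
    have hsq : ∫ ω, D p ω * D p ω ∂P ≤ (3 * K) ^ 2 := by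
      simp_rw [← sq]
      exact integral_degen_sample_sq_le h_meas hK hY hind (by simpa [S] using hp)
    rw [← Finset.sum_subset hsub (fun q hq hq' => by
      simp only [Finset.mem_insert, Finset.mem_singleton, not_or] at hq'
      exact hzero p hp q hq hq'.1 hq'.2), Finset.sum_pair hpne, hswap]
    linarith
  have hcard : (S.card : ℝ) = n * (n - 1) := by
    rw [Finset.offDiag_card, Finset.card_univ, Fintype.card_fin, Nat.cast_sub (Nat.le_mul_self n)]
    push_cast
    ring
  calc ∫ ω, (∑ p ∈ S, D p ω) ^ 2 ∂P = ∑ p ∈ S, ∑ q ∈ S, ∫ ω, D p ω * D q ω ∂P := by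
        simp_rw [sq, Finset.sum_mul_sum]
        rw [integral_finsetSum _ fun p hp => integrable_finsetSum _ fun q hq => hint p hp q hq]
        refine Finset.sum_congr rfl fun p hp => ?_
        rw [integral_finsetSum _ fun q hq => hint p hp q hq]
    _ ≤ ∑ p ∈ S, 2 * (3 * K : ℝ) ^ 2 := Finset.sum_le_sum hrow
    _ = 2 * (n * (n - 1)) * (3 * K) ^ 2 := by
        rw [Finset.sum_const, nsmul_eq_mul, hcard]
        ring

end Sample

/-! ### From the kernel decomposition to the joint limit. -/

/-- The Hoeffding decomposition of the U-statistic. -/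
lemma uStat_sub_kernelMean {𝒴 : Type*} [MeasurableSpace 𝒴] (h : 𝒴 → 𝒴 → ℝ) (μ : Measure 𝒴) {n : ℕ}
    (hn : 2 ≤ n) (y : Fin n → 𝒴) :
    uStat h y - kernelMean h μ = (n : ℝ)⁻¹ * ∑ i, 2 * proj h μ (y i)
      + 1 / ((n : ℝ) * (n - 1)) *
        ∑ p ∈ (Finset.univ : Finset (Fin n)).offDiag, degen h μ (y p.1, y p.2) := by
  have hn' : (2 : ℝ) ≤ n := by exact_mod_cast hn
  have hn1 : (n : ℝ) - 1 ≠ 0 := by linarith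
  have hn0 : (n : ℝ) ≠ 0 := by linarith
  set S := (Finset.univ : Finset (Fin n)).offDiag with hS
  have hcard : (S.card : ℝ) = n * (n - 1) := by
    rw [Finset.offDiag_card, Finset.card_univ, Fintype.card_fin, Nat.cast_sub (Nat.le_mul_self n)]
    push_cast
    ring
  have hoff (g : Fin n → Fin n → ℝ) :
      ∑ p ∈ S, g p.1 p.2 = ∑ i, ∑ j, g i j - ∑ i, g i i := by
    have h1 := Finset.sum_union (Finset.disjoint_diag_offDiag (Finset.univ : Finset (Fin n)))
      (f := fun p => g p.1 p.2)
    rw [Finset.diag_union_offDiag, Finset.sum_product, Finset.sum_diag] at h1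
    rw [h1]
    ring
  have hfst : ∑ p ∈ S, proj h μ (y p.1) = (n - 1) * ∑ i, proj h μ (y i) := by
    rw [hoff fun i _ => proj h μ (y i)]
    simp [← Finset.mul_sum]
    ring
  have hsnd : ∑ p ∈ S, proj h μ (y p.2) = (n - 1) * ∑ i, proj h μ (y i) := by
    rw [hoff fun _ j => proj h μ (y j)]
    simp
    ring
  simp only [degen, Finset.sum_sub_distrib, hfst, hsnd, Finset.sum_const, nsmul_eq_mul, hcard,
    uStat, ← Finset.mul_sum]
  field_simp
  ring

section Limit

variable {𝒴 Ω : Type*} [MeasurableSpace 𝒴] [MeasurableSpace Ω] {h : 𝒴 → 𝒴 → ℝ}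
  {γ : ℕ → Measure 𝒴} {P : Measure Ω}
  {Y : (n : ℕ) → ℕ → Fin n → Ω → 𝒴} {K : ℝ≥0}

lemma aemeasurable_uStat (h_meas : Measurable (Function.uncurry h)) {n : ℕ} {y : Fin n → Ω → 𝒴}
    (hy : ∀ i, AEMeasurable (y i) P) : AEMeasurable (fun ω => uStat h fun i => y i ω) P := by
  refine AEMeasurable.const_mul (Finset.aemeasurable_fun_sum _ fun p _ => ?_) _
  exact h_meas.comp_aemeasurable ((hy p.1).prodMk (hy p.2))

variable [∀ t, IsProbabilityMeasure (γ t)] [IsProbabilityMeasure P]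

/-- The linear part of the U-statistic is asymptotically normal as `n, t → ∞`. -/
lemma tendstoInDistribution_linear_part (h_meas : Measurable (Function.uncurry h))
    (Y_law : ∀ n t i, HasLaw (Y n t i) (γ t) P) (Y_indep : ∀ n t, iIndepFun (Y n t) P)
    (hK : ∀ᶠ t in atTop, centralMoment3 h (γ t) ≤ K) {σ : ℝ≥0}
    (hσ : Tendsto (fun t => projVariance h (γ t)) atTop (𝓝 ((σ : ℝ) ^ 2))) :
    TendstoInDistribution
      (fun (p : ℕ × ℕ) (ω : Ω) => (√(p.1 : ℝ))⁻¹ * ∑ i, 2 * proj h (γ p.2) (Y p.1 p.2 i ω))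
      (atTop ×ˢ atTop) (id : ℝ → ℝ) (fun _ => P) (gaussianReal 0 (σ ^ 2)) := by
  have hm : ∀ t, Measurable fun y => 2 * proj h (γ t) y := fun t =>
    (measurable_proj h_meas).const_mul 2
  refine ⟨fun p => ?_, aemeasurable_id, ?_⟩
  · exact (Finset.aemeasurable_fun_sum _ fun i _ =>
      (hm p.2).comp_aemeasurable (Y_law p.1 p.2 i).aemeasurable).const_mul _
  -- Reduction to sequences, along which Lévy's continuity theorem is applied.
  · refine tendsto_of_subseq_tendsto fun ns hns => ⟨id, ?_⟩
    refine ProbabilityMeasure.tendsto_of_tendsto_charFun fun s => ?_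
    suffices H : Tendsto (fun p : ℕ × ℕ =>
        charFun (P.map fun ω => (√(p.1 : ℝ))⁻¹ * ∑ i, 2 * proj h (γ p.2) (Y p.1 p.2 i ω)) s)
        (atTop ×ˢ atTop) (𝓝 (charFun (gaussianReal 0 (σ ^ 2)) s)) by
      simpa using! H.comp hns
    have h1 : Tendsto (fun p : ℕ × ℕ => ((p.1 : ℝ))⁻¹) (atTop ×ˢ atTop) (𝓝 0) :=
      tendsto_inv_atTop_zero.comp (tendsto_natCast_atTop_atTop.comp tendsto_fst)
    have h2 : Tendsto (fun p : ℕ × ℕ => (√(p.1 : ℝ))⁻¹) (atTop ×ˢ atTop) (𝓝 0) :=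
      tendsto_inv_atTop_zero.comp (Real.tendsto_sqrt_atTop.comp
        (tendsto_natCast_atTop_atTop.comp tendsto_fst))
    have h3 : Tendsto (fun p : ℕ × ℕ => |projVariance h (γ p.2) - σ ^ 2|)
        (atTop ×ˢ atTop) (𝓝 0) := by
      have := ((hσ.sub_const ((σ : ℝ) ^ 2)).abs).comp
        (tendsto_snd (f := (atTop : Filter ℕ)) (g := (atTop : Filter ℕ)))
      simpa [Function.comp_def] using this
    have hlim : Tendsto (fun p : ℕ × ℕ => 4 * |s| ^ 3 * (2 * K : ℝ≥0) ^ 3 * (√(p.1 : ℝ))⁻¹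
        + |projVariance h (γ p.2) - σ ^ 2| * s ^ 2 / 2
        + (σ ^ 2 * s ^ 2 / 2) ^ 2 * ((p.1 : ℝ))⁻¹) (atTop ×ˢ atTop) (𝓝 0) := by
      simpa using ((h2.const_mul (4 * |s| ^ 3 * ((2 * K : ℝ≥0) : ℝ) ^ 3)).add
        ((h3.mul_const (s ^ 2)).div_const 2)).add (h1.const_mul (((σ : ℝ) ^ 2 * s ^ 2 / 2) ^ 2))
    rw [tendsto_iff_norm_sub_tendsto_zero]
    refine squeeze_zero' (Eventually.of_forall fun _ => norm_nonneg _) ?_ hlim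
    filter_upwards [tendsto_fst.eventually (eventually_gt_atTop 0), tendsto_snd.eventually hK]
      with p hp hKp
    have hK2 : eLpNorm (fun y => 2 * proj h (γ p.2) y) 3 (γ p.2) ≤ (2 * K : ℝ≥0) := by
      have := eLpNorm_const_smul_le (c := (2 : ℝ)) (f := proj h (γ p.2)) (p := 3) (μ := γ p.2)
      refine this.trans ?_
      rw [ENNReal.coe_mul]
      gcongr
      · simp [enorm_eq_nnnorm]
      · exact eLpNorm_proj_le h_meas hKp
    have hb := norm_charFun_normalized_sum_sub_le hp (Y_law p.1 p.2) (Y_indep p.1 p.2) (hm p.2) hK2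
      (by rw [integral_const_mul, integral_proj h_meas hKp, mul_zero]) σ s
    rwa [integral_two_mul_proj_sq h_meas hKp] at hb

/-- The degenerate part of the U-statistic is negligible at the scale `√n` as `n, t → ∞`. -/
lemma tendstoInMeasure_uStat_sub_linear_part (h_meas : Measurable (Function.uncurry h))
    (h_symm : ∀ y y', h y y' = h y' y)
    (Y_law : ∀ n t i, HasLaw (Y n t i) (γ t) P) (Y_indep : ∀ n t, iIndepFun (Y n t) P)
    (hK : ∀ᶠ t in atTop, centralMoment3 h (γ t) ≤ K) :
    TendstoInMeasure P
      ((fun (p : ℕ × ℕ) (ω : Ω) => √(p.1 : ℝ) *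
          (uStat h (fun i => Y p.1 p.2 i ω) - kernelMean h (γ p.2)))
        - fun (p : ℕ × ℕ) (ω : Ω) => (√(p.1 : ℝ))⁻¹ * ∑ i, 2 * proj h (γ p.2) (Y p.1 p.2 i ω))
      (atTop ×ˢ atTop) 0 := by
  have hYm : ∀ n t i, AEMeasurable (Y n t i) P := fun n t i => (Y_law n t i).aemeasurable
  refine tendstoInMeasure_of_tendsto_eLpNorm (p := 2) (by norm_num) (fun p => ?_)
    aestronglyMeasurable_zero ?_
  · refine AEMeasurable.aestronglyMeasurable (AEMeasurable.sub ?_ ?_)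
    · exact ((aemeasurable_uStat h_meas (hYm p.1 p.2)).sub_const _).const_mul _
    · exact (Finset.aemeasurable_fun_sum _ fun i _ =>
        ((measurable_proj h_meas).const_mul 2).comp_aemeasurable (hYm p.1 p.2 i)).const_mul _
  have hlim : Tendsto (fun p : ℕ × ℕ => ENNReal.ofReal (√(2 * (3 * K) ^ 2 * ((p.1 : ℝ) - 1)⁻¹)))
      (atTop ×ˢ atTop) (𝓝 0) := by
    have h1 : Tendsto (fun p : ℕ × ℕ => ((p.1 : ℝ) - 1)⁻¹) (atTop ×ˢ atTop) (𝓝 0) :=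
      tendsto_inv_atTop_zero.comp ((tendsto_atTop_add_const_right _ (-1)
        tendsto_natCast_atTop_atTop).comp tendsto_fst)
    simpa using ENNReal.tendsto_ofReal ((h1.const_mul (2 * (3 * (K : ℝ)) ^ 2)).sqrt)
  refine tendsto_of_tendsto_of_tendsto_of_le_of_le' tendsto_const_nhds hlim
    (Eventually.of_forall fun _ => zero_le) ?_
  filter_upwards [tendsto_fst.eventually (eventually_ge_atTop 2), tendsto_snd.eventually hK]
    with p hp hKp
  obtain ⟨n, t⟩ := p
  simp only at hp hKp
  have hn : (2 : ℝ) ≤ n := by exact_mod_cast hp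
  have hn1 : (0 : ℝ) < n - 1 := by linarith
  have hn0 : (0 : ℝ) < n := by linarith
  set S := (Finset.univ : Finset (Fin n)).offDiag with hS
  let R : Ω → ℝ := fun ω => √(n : ℝ) * (1 / ((n : ℝ) * (n - 1)))
    * ∑ p ∈ S, degen h (γ t) (Y n t p.1 ω, Y n t p.2 ω)
  have hR : (fun ω => √(n : ℝ) * (uStat h (fun i => Y n t i ω) - kernelMean h (γ t))
      - (√(n : ℝ))⁻¹ * ∑ i, 2 * proj h (γ t) (Y n t i ω)) = R := by
    funext ω
    rw [uStat_sub_kernelMean h (γ t) hp]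
    have : (√(n : ℝ))⁻¹ = √(n : ℝ) * (n : ℝ)⁻¹ := by
      have := Real.mul_self_sqrt hn0.le
      field_simp
      linarith
    rw [this]
    simp only [R]
    ring
  have hRmem : MemLp R 2 P := by
    have hsum : MemLp (fun ω => ∑ p ∈ S, degen h (γ t) (Y n t p.1 ω, Y n t p.2 ω)) 2 P :=
      memLp_finsetSum S fun q hq =>
        memLp_degen_sample h_meas hKp (Y_law n t) (Y_indep n t) (Finset.mem_offDiag.1 hq).2.2
    exact hsum.const_mul _
  -- The squared prefactor is `n / (n (n - 1))²`, so against the `2 n (n - 1) (3K)²` of the sum one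
  -- factor `1 / (n - 1)` survives.
  have hRsq : ∫ ω, R ω ^ 2 ∂P ≤ 2 * (3 * K) ^ 2 * ((n : ℝ) - 1)⁻¹ := by
    simp only [R, mul_pow _ (∑ p ∈ S, _)]
    rw [integral_const_mul]
    calc _ ≤ (√(n : ℝ) * (1 / ((n : ℝ) * (n - 1)))) ^ 2 * (2 * (n * (n - 1)) * (3 * K) ^ 2) := by
          gcongr
          exact integral_sum_degen_sq_le h_meas h_symm hKp (Y_law n t) (Y_indep n t)
      _ = 2 * (3 * K) ^ 2 * ((n : ℝ) - 1)⁻¹ := by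
          rw [mul_pow, Real.sq_sqrt hn0.le]
          field_simp
  have hb := eLpNorm_two_le_of_integral_sq_le hRmem hRsq
  rw [← hR] at hb
  simpa using! hb

/-- Asymptotic normality of the U-statistic centered at its own mean as `n, t → ∞`. -/
lemma tendstoInDistribution_uStat_sub_kernelMean (h_meas : Measurable (Function.uncurry h))
    (h_symm : ∀ y y', h y y' = h y' y)
    (Y_law : ∀ n t i, HasLaw (Y n t i) (γ t) P) (Y_indep : ∀ n t, iIndepFun (Y n t) P)
    (hK : ∀ᶠ t in atTop, centralMoment3 h (γ t) ≤ K) {σ : ℝ≥0}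
    (hσ : Tendsto (fun t => projVariance h (γ t)) atTop (𝓝 ((σ : ℝ) ^ 2))) :
    TendstoInDistribution
      (fun (p : ℕ × ℕ) (ω : Ω) => √(p.1 : ℝ) *
        (uStat h (fun i => Y p.1 p.2 i ω) - kernelMean h (γ p.2)))
      (atTop ×ˢ atTop) (id : ℝ → ℝ) (fun _ => P) (gaussianReal 0 (σ ^ 2)) :=
  tendstoInDistribution_of_tendstoInMeasure_sub _ _
    (tendstoInDistribution_linear_part h_meas Y_law Y_indep hK hσ)
    (tendstoInMeasure_uStat_sub_linear_part h_meas h_symm Y_law Y_indep hK)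
    fun p => ((aemeasurable_uStat h_meas
      fun i => (Y_law p.1 p.2 i).aemeasurable).sub_const _).const_mul _

end Limit

end ApproxUStat

theorem theorem1
    {𝒴 : Type*} [TopologicalSpace 𝒴] [PolishSpace 𝒴] [MeasurableSpace 𝒴] [BorelSpace 𝒴]
    (γ : ℕ → Measure 𝒴) [∀ t, IsProbabilityMeasure (γ t)]
    (γlim : Measure 𝒴) [IsProbabilityMeasure γlim]
    -- the symmetric kernel, with a well-defined mean under `γlim ⊗ γlim`
    (h : 𝒴 → 𝒴 → ℝ) (h_meas : Measurable (Function.uncurry h))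
    (h_symm : ∀ y y', h y y' = h y' y)
    (h_int : Integrable (fun p : 𝒴 × 𝒴 => h p.1 p.2) (γlim.prod γlim))
    -- for all `n` and `t`, an i.i.d. sample of size `n` from `γ t`
    {Ω : Type*} [MeasurableSpace Ω] (P : Measure Ω) [IsProbabilityMeasure P]
    (Y : (n : ℕ) → ℕ → Fin n → Ω → 𝒴)
    (Y_law : ∀ n t i, HasLaw (Y n t i) (γ t) P)
    (Y_indep : ∀ n t, iIndepFun (Y n t) P)
    (σ : ℝ≥0)
    (hν : limsup (fun t => ApproxUStat.centralMoment3 h (γ t)) atTop < ∞)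
    (hσ : Tendsto (fun t => ApproxUStat.projVariance h (γ t)) atTop (𝓝 ((σ : ℝ) ^ 2)))
    -- the mode in which `(n, t) → (∞, ∞)`: the unrestricted double limit is
    -- `l = atTop ×ˢ atTop`; a joint limit along `t = t(n)` is another case
    (l : Filter (ℕ × ℕ)) (hl : l ≤ atTop ×ˢ atTop)
    (hθ : Tendsto (fun p : ℕ × ℕ => √(p.1 : ℝ) *
      (ApproxUStat.kernelMean h (γ p.2) - ApproxUStat.kernelMean h γlim)) l (𝓝 0)) :
    (0 < σ →
      TendstoInDistribution
        (fun (p : ℕ × ℕ) (ω : Ω) => √(p.1 : ℝ) *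
          (ApproxUStat.uStat h (fun i => Y p.1 p.2 i ω) - ApproxUStat.kernelMean h γlim))
        l (id : ℝ → ℝ) (fun _ => P) (gaussianReal 0 (σ ^ 2))) ∧
    (σ = 0 →
      TendstoInMeasure P
        (fun (p : ℕ × ℕ) (ω : Ω) => √(p.1 : ℝ) *
          (ApproxUStat.uStat h (fun i => Y p.1 p.2 i ω) - ApproxUStat.kernelMean h γlim))
        l (fun _ => 0)) := by
  have hK : ∃ K : ℝ≥0, ∀ᶠ t in atTop, ApproxUStat.centralMoment3 h (γ t) ≤ K := by
    obtain ⟨K, hK1, hK2⟩ := ENNReal.lt_iff_exists_nnreal_btwn.1 hν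
    exact ⟨K, (eventually_lt_of_limsup_lt hK1).mono fun t ht => ht.le⟩
  obtain ⟨K, hK⟩ := hK
  have hmain := ApproxUStat.tendstoInDistribution_uStat_sub_kernelMean h_meas h_symm Y_law Y_indep
    hK hσ
  have hmain_l : TendstoInDistribution
      (fun (p : ℕ × ℕ) (ω : Ω) => √(p.1 : ℝ) *
        (ApproxUStat.uStat h (fun i => Y p.1 p.2 i ω) - ApproxUStat.kernelMean h (γ p.2)))
      l (id : ℝ → ℝ) (fun _ => P) (gaussianReal 0 (σ ^ 2)) :=
    ⟨hmain.forall_aemeasurable, hmain.aemeasurable_limit, hmain.tendsto.mono_left hl⟩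
  have hlim : TendstoInDistribution
      (fun (p : ℕ × ℕ) (ω : Ω) => √(p.1 : ℝ) *
        (ApproxUStat.uStat h (fun i => Y p.1 p.2 i ω) - ApproxUStat.kernelMean h γlim))
      l (id : ℝ → ℝ) (fun _ => P) (gaussianReal 0 (σ ^ 2)) := by
    -- `√n (U_n - θ) = √n (U_n - θ_t) + √n (θ_t - θ)`, the last term being deterministic.
    convert ApproxUStat.tendstoInDistribution_add_tendsto_zero hmain_l hθ using 3
    ring
  refine ⟨fun _ => hlim, fun hσ0 => ?_⟩
  subst hσ0
  rw [zero_pow two_ne_zero] at hlim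
  exact ApproxUStat.tendstoInMeasure_zero_of_tendstoInDistribution hlim
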